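/- Let $n\in\mathbb N$ and let $\Omega\subset\mathbb R^n$ (with the Euclidean inner product $\langle\cdot,\cdot\rangle$ and norm $\|\cdot\|$) be closed, convex and proper, i.e. $\Omega\neq\emptyset$ and $\Omega^c:=\mathbb R^n\setminus\Omega\neq\emptyset$. For a nonempty set $\Theta\subset\mathbb R^n$ put $d(x;\Theta):=\inf\{\|w-x\| : w\in\Theta\}$ and $\Pi(x;\Theta):=\{w\in\Theta : \|x-w\|=d(x;\Theta)\}$. Define the signed distance function by $\widehat d(x;\Omega):=d(x;\Omega)$ if $x\in\Omega^c$ and $\widehat d(x;\Omega):=-d(x;\Omega^c)$ if $x\in\Omega$, and let $Q_\Omega(x):=\Pi(x;\overline{\Omega})$ if $x\in\Omega^c$ and $Q_\Omega(x):=\Pi(x;\overline{\Omega^c})$ if $x\in\Omega$. Let $\partial\widehat d(\bar x;\Omega):=\{v\in\mathbb R^n : \langle v,x-\bar x\rangle\le\widehat d(x;\Omega)-\widehat d(\bar x;\Omega)\text{ for all }x\in\mathbb R^n\}$ be the convex subdifferential of $\widehat d(\cdot;\Omega)$ at $\bar x$, let $N(\bar x;\Omega):=\{v\in\mathbb R^n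 : \langle v,x-\bar x\rangle\le 0\text{ for all }x\in\Omega\}$ be the normal cone to $\Omega$ at $\bar x\in\Omega$, let $\mathbb S:=\{v\in\mathbb R^n : \|v\|=1\}$, and let $\operatorname{co}$ denote the convex hull. Then for every $\bar x\in\mathbb R^n$ $$\partial\widehat d(\bar x;\Omega)=\begin{cases}\Big\{\dfrac{\bar x-w}{\widehat d(\bar x;\Omega)} : w\in Q_\Omega(\bar x)\Big\} & \text{if }\bar x\in\Omega^c,\\[2ex] \Big\{\dfrac{\bar x-w}{\widehat d(\bar x;\Omega)} : w\in\operatorname{co}Q_\Omega(\bar x)\Big\} & \text{if }\bar x\in\operatorname{int}\Omega,\\[2ex] \operatorname{co}\big(\mathbb S\cap N(\bar x;\Omega)\big) & \text{if }\bar x\in\operatorname{bd}\Omega.\end{cases}$$ -/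

import Mathlib

namespace SignedDistance

variable {E : Type*} [NormedAddCommGroup E] [InnerProductSpace ℝ E]

/-- The convex subdifferential of a real-valued function `f` at `x`; the dual space is
identified with the space itself through the inner product. -/
def subdifferential (f : E → ℝ) (x : E) : Set E :=
  {v | ∀ y : E, inner ℝ v (y - x) ≤ f y - f x}

/-- The normal cone to a convex set `Ω` at `x`; it is empty if `x ∉ Ω`. -/
def normalCone (Ω : Set E) (x : E) : Set E :=
  {v | x ∈ Ω ∧ ∀ y ∈ Ω, inner ℝ v (y - x) ≤ 0}

/-- The set of nearest points of `Θ` to `x`. -/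
def proj (x : E) (Θ : Set E) : Set E :=
  {w | w ∈ Θ ∧ ‖x - w‖ = Metric.infDist x Θ}

open Classical in
/-- The signed distance function of `Ω`: the distance to `Ω` outside of `Ω`, and minus the
distance to the complement of `Ω` on `Ω`. -/
noncomputable def signedDistance (Ω : Set E) (x : E) : ℝ :=
  if x ∈ Ω then -Metric.infDist x Ωᶜ else Metric.infDist x Ω

open Classical in
/-- The projections of `x` to the closure of `Ω` if `x ∉ Ω`, and to the closure of the
complement of `Ω` if `x ∈ Ω`. -/
noncomputable def signedProj (Ω : Set E) (x : E) : Set E :=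
  if x ∈ Ω then proj x (closure Ωᶜ) else proj x (closure Ω)

end SignedDistance

namespace SignedDistance

open Metric Set Filter Topology

/-! The signed distance is a maximum of affine functions: for each unit `v` whose half-space
contains `Ω`, the signed distance to that half-space is a lower bound (`le_signedDistance`), and
some `v` attains it at every point (`activeNormals_nonempty`). As for any maximum over a compact
family, the subdifferential is the convex hull of the maximizers, here `activeNormals`
(`subdifferential_signedDistance`). It remains to identify these maximizers outside, inside and on
the boundary of `Ω`; the equality case of Cauchy–Schwarz links them to nearest points. -/

/-- In a finite-dimensional space the convex hull of a compact set is compact. -/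
theorem isCompact_convexHull_of_isCompact {F : Type*} [NormedAddCommGroup F] [NormedSpace ℝ F]
    [FiniteDimensional ℝ F] {s : Set F} (hs : IsCompact s) : IsCompact (convexHull ℝ s) := by
  let φ : (k : ℕ) → (Fin k → ℝ) × (Fin k → F) → F := fun k p => ∑ i, p.1 i • p.2 i
  -- Carathéodory: `finrank + 1` points suffice, so the hull is a finite union of continuous images
  -- of compact sets.
  have key : convexHull ℝ s = ⋃ k ∈ Finset.range (Module.finrank ℝ F + 2),
      φ k '' (stdSimplex ℝ (Fin k) ×ˢ Set.pi univ fun _ => s) := by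
    apply Subset.antisymm
    · intro x hx
      obtain ⟨ι, _, z, w, hz, hind, hw, hsum, rfl⟩ := eq_pos_convex_span_of_mem_convexHull hx
      have hcard : Fintype.card ι ≤ Module.finrank ℝ F + 1 :=
        hind.card_le_finrank_succ.trans (by gcongr; exact Submodule.finrank_le _)
      let e := Fintype.equivFin ι
      refine mem_iUnion₂.2 ⟨Fintype.card ι, Finset.mem_range.2 (by omega),
        (w ∘ e.symm, z ∘ e.symm), ⟨⟨fun i => (hw _).le, ?_⟩, fun i _ => hz ⟨_, rfl⟩⟩, ?_⟩
      · rw [← hsum]; exact e.symm.sum_comp w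
      · exact e.symm.sum_comp fun i => w i • z i
    · refine iUnion₂_subset fun k _ => ?_
      rintro _ ⟨⟨w, z⟩, ⟨hw, hz⟩, rfl⟩
      exact (convex_convexHull ℝ s).sum_mem (fun i _ => hw.1 i) hw.2
        fun i _ => subset_convexHull ℝ s (hz i (mem_univ i))
  rw [key]
  refine Finset.isCompact_biUnion _ fun k _ => ?_
  refine ((isCompact_stdSimplex ℝ (Fin k)).prod (isCompact_univ_pi fun _ => hs)).image ?_
  fun_prop

section Unfolding

variable {F : Type*} [NormedAddCommGroup F]

theorem signedDistance_of_mem {Ω : Set F} {x : F} (hx : x ∈ Ω) :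
    signedDistance Ω x = -infDist x Ωᶜ := if_pos hx

theorem signedDistance_of_notMem {Ω : Set F} {x : F} (hx : x ∉ Ω) :
    signedDistance Ω x = infDist x Ω := if_neg hx

theorem signedProj_of_mem {Ω : Set F} {x : F} (hx : x ∈ Ω) :
    signedProj Ω x = proj x (closure Ωᶜ) := if_pos hx

theorem signedProj_of_notMem {Ω : Set F} {x : F} (hx : x ∉ Ω) :
    signedProj Ω x = proj x (closure Ω) := if_neg hx

end Unfolding

variable {E : Type*} [NormedAddCommGroup E] [InnerProductSpace ℝ E]

theorem inner_le_norm_of_norm_eq_one {v : E} (hv : ‖v‖ = 1) (u : E) : inner ℝ v u ≤ ‖u‖ := by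
  simpa [hv] using real_inner_le_norm v u

theorem inner_self_of_norm_eq_one {v : E} (hv : ‖v‖ = 1) : inner ℝ v v = (1 : ℝ) := by
  simp [hv]

/-- The equality case of the Cauchy–Schwarz inequality for a unit vector. -/
theorem eq_smul_of_norm_le_inner {v u : E} (hv : ‖v‖ = 1) (h : ‖u‖ ≤ inner ℝ v u) :
    u = ‖u‖ • v := by
  have h' : inner ℝ v u = ‖v‖ * ‖u‖ := by
    rw [hv, one_mul]; exact le_antisymm (inner_le_norm_of_norm_eq_one hv u) h
  simpa [hv] using (inner_eq_norm_mul_iff_real.1 h').symm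

theorem convex_subdifferential (f : E → ℝ) (x : E) : Convex ℝ (subdifferential f x) := by
  intro v hv w hw a b ha hb hab y
  have h₁ := mul_le_mul_of_nonneg_left (hv y) ha
  have h₂ := mul_le_mul_of_nonneg_left (hw y) hb
  rw [inner_add_left, real_inner_smul_left, real_inner_smul_left]
  calc _ ≤ a * (f y - f x) + b * (f y - f x) := add_le_add h₁ h₂
    _ = f y - f x := by rw [← add_mul, hab, one_mul]

/-! ### Half-spaces containing `Ω` and their active normals. -/

/-- The unit normals of the half-spaces containing `Ω` whose signed distance at `x` agrees with
that of `Ω`. -/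
def activeNormals (Ω : Set E) (x : E) : Set E :=
  {v | ‖v‖ = 1 ∧ ∀ y ∈ Ω, signedDistance Ω x ≤ inner ℝ v (x - y)}

/-- The signed distance of `Ω` is bounded below by that of any half-space containing `Ω`. -/
theorem le_signedDistance {Ω : Set E} (hne : Ω.Nonempty) {v x : E} {c : ℝ} (hv : ‖v‖ = 1)
    (h : ∀ y ∈ Ω, c ≤ inner ℝ v (x - y)) : c ≤ signedDistance Ω x := by
  by_cases hx : x ∈ Ω
  · have hc : c ≤ 0 := by simpa using h x hx
    rw [signedDistance_of_mem hx, le_neg]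
    refine le_of_forall_pos_le_add fun ε hε => ?_
    -- Moving from `x` along `v` by more than `-c` leaves the half-space, hence `Ω`.
    have hmem : x + (-c + ε) • v ∈ Ωᶜ := fun hmem => by
      have := h _ hmem
      rw [sub_add_cancel_left, inner_neg_right, real_inner_smul_right,
        inner_self_of_norm_eq_one hv] at this
      linarith
    refine (infDist_le_dist_of_mem hmem).trans ?_
    rw [dist_self_add_right, norm_smul, hv, mul_one, Real.norm_of_nonneg (by linarith)]
  · rw [signedDistance_of_notMem hx, le_infDist hne]
    intro y hy
    rw [dist_eq_norm]
    exact (h y hy).trans (inner_le_norm_of_norm_eq_one hv _)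

theorem activeNormals_subset_subdifferential {Ω : Set E} (hne : Ω.Nonempty) (x : E) :
    activeNormals Ω x ⊆ subdifferential (signedDistance Ω) x := by
  rintro v ⟨hv, hvx⟩ z
  rw [le_sub_iff_add_le]
  refine le_signedDistance hne hv fun y hy => ?_
  have := hvx y hy
  rw [show z - y = (z - x) + (x - y) by abel, inner_add_right]
  linarith

theorem eq_of_mem_activeNormals_of_notMem {Ω : Set E} (hne : Ω.Nonempty) (hclosed : IsClosed Ω)
    {x v w : E} (hx : x ∉ Ω) (hv : v ∈ activeNormals Ω x) (hw : w ∈ signedProj Ω x) :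
    v = (signedDistance Ω x)⁻¹ • (x - w) := by
  rw [signedProj_of_notMem hx, hclosed.closure_eq] at hw
  have hpos : 0 < infDist x Ω := (hclosed.notMem_iff_infDist_pos hne).1 hx
  have hle := hv.2 w hw.1
  rw [signedDistance_of_notMem hx] at hle ⊢
  rw [eq_smul_of_norm_le_inner hv.1 (hw.2.le.trans hle), hw.2, smul_smul,
    inv_mul_cancel₀ hpos.ne', one_smul]

section FiniteDimensional

variable [FiniteDimensional ℝ E]

theorem isCompact_activeNormals (Ω : Set E) (x : E) : IsCompact (activeNormals Ω x) := by
  have : activeNormals Ω x =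
      sphere (0 : E) 1 ∩ ⋂ y ∈ Ω, {v | signedDistance Ω x ≤ inner ℝ v (x - y)} := by
    ext v; simp [activeNormals]
  rw [this]
  exact (isCompact_sphere _ _).inter_right
    (isClosed_biInter fun y _ => isClosed_le continuous_const (by fun_prop))

/-- A unit vector separating a point from a closed convex set, pointing along the projection. -/
theorem exists_unit_infDist_le_inner {Ω : Set E} (hne : Ω.Nonempty) (hclosed : IsClosed Ω)
    (hconv : Convex ℝ Ω) {x : E} (hx : x ∉ Ω) :
    ∃ v : E, ‖v‖ = 1 ∧ ∀ y ∈ Ω, infDist x Ω ≤ inner ℝ v (x - y) := by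
  obtain ⟨p, hp, hpx⟩ := hclosed.exists_infDist_eq_dist hne x
  have hxp : 0 < ‖x - p‖ := norm_pos_iff.2 (sub_ne_zero.2 fun h => hx (h ▸ hp))
  have hproj : ∀ y ∈ Ω, inner ℝ (x - p) (y - p) ≤ (0 : ℝ) := by
    have : Nonempty Ω := ⟨⟨p, hp⟩⟩
    refine (norm_eq_iInf_iff_real_inner_le_zero hconv hp).1 (le_antisymm ?_ ?_)
    · refine le_ciInf fun w => ?_
      rw [← dist_eq_norm, ← dist_eq_norm, ← hpx]
      exact infDist_le_dist_of_mem w.2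
    · exact ciInf_le ⟨0, by rintro _ ⟨w, rfl⟩; exact norm_nonneg _⟩ (⟨p, hp⟩ : Ω)
  refine ⟨‖x - p‖⁻¹ • (x - p), by rw [norm_smul, norm_inv, norm_norm, inv_mul_cancel₀ hxp.ne'], fun y hy => ?_⟩
  have h := hproj y hy
  rw [hpx, dist_eq_norm, real_inner_smul_left, inv_mul_eq_div, le_div_iff₀ hxp,
    show x - y = (x - p) - (y - p) by abel, inner_sub_right, real_inner_self_eq_norm_mul_norm]
  linarith

/-- A closed convex set lies in a half-space through each point of the closure of its
complement. -/
theorem exists_unit_inner_le_zero {Ω : Set E} (hne : Ω.Nonempty) (hclosed : IsClosed Ω)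
    (hconv : Convex ℝ Ω) {w : E} (hw : w ∈ closure Ωᶜ) :
    ∃ v : E, ‖v‖ = 1 ∧ ∀ y ∈ Ω, 0 ≤ inner ℝ v (w - y) := by
  -- Separating unit vectors at exterior points tending to `w` subconverge, since the sphere is
  -- compact.
  obtain ⟨u, hu, hlim⟩ := mem_closure_iff_seq_limit.1 hw
  choose v hv hvy using fun k => exists_unit_infDist_le_inner hne hclosed hconv (hu k)
  obtain ⟨v₀, hv₀, φ, hφ, hvφ⟩ := (isCompact_sphere (0 : E) 1).tendsto_subseq
    (x := v) fun k => by simpa using hv k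
  refine ⟨v₀, by simpa using hv₀, fun y hy => ?_⟩
  refine ge_of_tendsto' (hvφ.inner ((hlim.comp hφ.tendsto_atTop).sub_const y)) fun k => ?_
  exact infDist_nonneg.trans (hvy (φ k) y hy)

theorem activeNormals_nonempty {Ω : Set E} (hne : Ω.Nonempty) (hcne : Ωᶜ.Nonempty)
    (hclosed : IsClosed Ω) (hconv : Convex ℝ Ω) (x : E) : (activeNormals Ω x).Nonempty := by
  by_cases hx : x ∈ Ω
  · obtain ⟨w, hw, hwx⟩ := exists_mem_closure_infDist_eq_dist hcne x
    obtain ⟨v, hv, hvy⟩ := exists_unit_inner_le_zero hne hclosed hconv hw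
    refine ⟨v, hv, fun y hy => ?_⟩
    have h₁ := hvy y hy
    have h₂ := inner_le_norm_of_norm_eq_one hv (w - x)
    rw [← neg_sub x w, inner_neg_right, norm_neg] at h₂
    rw [signedDistance_of_mem hx, hwx, dist_eq_norm,
      show x - y = (x - w) + (w - y) by abel, inner_add_right]
    linarith
  · obtain ⟨v, hv, hvy⟩ := exists_unit_infDist_le_inner hne hclosed hconv hx
    exact ⟨v, hv, by rwa [signedDistance_of_notMem hx]⟩

/-- Let `v k` be active at `x + t k • h`. Being a subgradient there, it bounds the difference
quotient above by `⟪v k, h⟫`, while `g` bounds it below by `⟪g, h⟫`. A limit of the `v k` is active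
at `x` and keeps the inequality. -/
theorem exists_activeNormals_inner_le {Ω : Set E} (hne : Ω.Nonempty) (hcne : Ωᶜ.Nonempty)
    (hclosed : IsClosed Ω) (hconv : Convex ℝ Ω) {x g : E}
    (hg : g ∈ subdifferential (signedDistance Ω) x) (h : E) :
    ∃ v ∈ activeNormals Ω x, inner ℝ g h ≤ (inner ℝ v h : ℝ) := by
  let t : ℕ → ℝ := fun k => 1 / ((k : ℝ) + 1)
  have ht : ∀ k, 0 < t k := fun k => Nat.one_div_pos_of_nat
  have htlim : Tendsto t atTop (𝓝 0) := tendsto_one_div_add_atTop_nhds_zero_nat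
  choose v hv hvy using fun k => activeNormals_nonempty hne hcne hclosed hconv (x + t k • h)
  obtain ⟨v₀, hv₀, φ, hφ, hvφ⟩ := (isCompact_sphere (0 : E) 1).tendsto_subseq
    (x := v) fun k => by simpa using hv k
  have htφ : Tendsto (fun k => t (φ k)) atTop (𝓝 0) := htlim.comp hφ.tendsto_atTop
  have hgk : ∀ k, t k * inner ℝ g h ≤ signedDistance Ω (x + t k • h) - signedDistance Ω x := by
    intro k
    have := hg (x + t k • h)
    rwa [add_sub_cancel_left, real_inner_smul_right] at this
  refine ⟨v₀, ⟨by simpa using hv₀, fun y hy => ?_⟩, ?_⟩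
  · have h₁ : Tendsto (fun k => signedDistance Ω x + t (φ k) * inner ℝ g h) atTop
        (𝓝 (signedDistance Ω x + 0 * inner ℝ g h)) :=
      tendsto_const_nhds.add (htφ.mul_const _)
    have h₂ : Tendsto (fun k => inner ℝ (v (φ k)) (x + t (φ k) • h - y)) atTop
        (𝓝 (inner ℝ v₀ (x + (0 : ℝ) • h - y))) :=
      hvφ.inner (((htφ.smul_const h).const_add x).sub_const y)
    have := le_of_tendsto_of_tendsto' h₁ h₂ fun k => by
      have h₃ := hgk (φ k)
      have h₄ := hvy (φ k) y hy
      linarith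
    simpa using this
  · refine ge_of_tendsto' (hvφ.inner (tendsto_const_nhds (x := h))) fun k => ?_
    refine le_of_mul_le_mul_left ((hgk (φ k)).trans ?_) (ht (φ k))
    have := activeNormals_subset_subdifferential hne _ ⟨hv (φ k), hvy (φ k)⟩ x
    rw [sub_add_cancel_left, inner_neg_right, real_inner_smul_right] at this
    simp only [Function.comp_apply]
    linarith

theorem subdifferential_signedDistance {Ω : Set E} (hne : Ω.Nonempty) (hcne : Ωᶜ.Nonempty)
    (hclosed : IsClosed Ω) (hconv : Convex ℝ Ω) (x : E) :
    subdifferential (signedDistance Ω) x = convexHull ℝ (activeNormals Ω x) := by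
  refine Subset.antisymm (fun g hg => ?_) (convexHull_min
    (activeNormals_subset_subdifferential hne x) (convex_subdifferential _ _))
  by_contra hgn
  obtain ⟨f, u, hf, hu⟩ := geometric_hahn_banach_closed_point (convex_convexHull ℝ _)
    (isCompact_convexHull_of_isCompact (isCompact_activeNormals Ω x)).isClosed hgn
  -- The direction `h` is the Riesz vector of the functional separating `g` from the hull.
  obtain ⟨v, hv, hgv⟩ := exists_activeNormals_inner_le hne hcne hclosed hconv hg
    ((InnerProductSpace.toDual ℝ E).symm f)
  rw [real_inner_comm, real_inner_comm _ v, InnerProductSpace.toDual_symm_apply,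
    InnerProductSpace.toDual_symm_apply] at hgv
  exact absurd (hf v (subset_convexHull ℝ _ hv)) (by linarith)

/-! ### Active normals in the three cases. -/

theorem signedProj_nonempty {Ω : Set E} (hne : Ω.Nonempty) (hcne : Ωᶜ.Nonempty) (x : E) :
    (signedProj Ω x).Nonempty := by
  by_cases hx : x ∈ Ω
  · obtain ⟨w, hw, h⟩ := isClosed_closure.exists_infDist_eq_dist hcne.closure x
    exact ⟨w, by rw [signedProj_of_mem hx]; exact ⟨hw, by rw [h, dist_eq_norm]⟩⟩
  · obtain ⟨w, hw, h⟩ := isClosed_closure.exists_infDist_eq_dist hne.closure x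
    exact ⟨w, by rw [signedProj_of_notMem hx]; exact ⟨hw, by rw [h, dist_eq_norm]⟩⟩

theorem activeNormals_of_notMem {Ω : Set E} (hne : Ω.Nonempty) (hcne : Ωᶜ.Nonempty)
    (hclosed : IsClosed Ω) (hconv : Convex ℝ Ω) {x : E} (hx : x ∉ Ω) :
    activeNormals Ω x = (fun w => (signedDistance Ω x)⁻¹ • (x - w)) '' signedProj Ω x := by
  obtain ⟨v, hv⟩ := activeNormals_nonempty hne hcne hclosed hconv x
  obtain ⟨w, hw⟩ := signedProj_nonempty hne hcne x
  apply Subset.antisymm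
  · exact fun v' hv' => ⟨w, hw, (eq_of_mem_activeNormals_of_notMem hne hclosed hx hv' hw).symm⟩
  · rintro _ ⟨w', hw', rfl⟩
    simpa only [← eq_of_mem_activeNormals_of_notMem hne hclosed hx hv hw'] using hv

theorem subsingleton_activeNormals_of_notMem {Ω : Set E} (hne : Ω.Nonempty)
    (hcne : Ωᶜ.Nonempty) (hclosed : IsClosed Ω) {x : E} (hx : x ∉ Ω) :
    (activeNormals Ω x).Subsingleton := by
  obtain ⟨w, hw⟩ := signedProj_nonempty hne hcne x
  intro v hv v' hv'
  rw [eq_of_mem_activeNormals_of_notMem hne hclosed hx hv hw,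
    ← eq_of_mem_activeNormals_of_notMem hne hclosed hx hv' hw]

theorem activeNormals_of_mem_interior {Ω : Set E} (hne : Ω.Nonempty) (hcne : Ωᶜ.Nonempty)
    (hclosed : IsClosed Ω) (hconv : Convex ℝ Ω) {x : E} (hx : x ∈ interior Ω) :
    activeNormals Ω x = (fun w => (signedDistance Ω x)⁻¹ • (x - w)) '' signedProj Ω x := by
  have hxΩ := interior_subset hx
  set δ := infDist x Ωᶜ with hδ
  have hpos : 0 < δ := (infDist_pos_iff_notMem_closure hcne).1 <| by
    rwa [closure_compl, notMem_compl_iff]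
  have hd : signedDistance Ω x = -δ := signedDistance_of_mem hxΩ
  rw [signedProj_of_mem hxΩ, hd]
  apply Subset.antisymm
  · rintro v ⟨hv, hvy⟩
    rw [hd] at hvy
    refine ⟨x + δ • v, ⟨?_, ?_⟩, ?_⟩
    · have hlim : Tendsto (fun s : ℝ => x + s • v) (𝓝[>] δ) (𝓝 (x + δ • v)) :=
        ((by fun_prop : Continuous fun s : ℝ => x + s • v).tendsto δ).mono_left
          nhdsWithin_le_nhds
      -- Past length `δ` the ray along `v` has left the half-space, so its endpoint is a limit of
      -- points of the complement.
      refine mem_closure_of_tendsto hlim (eventually_nhdsWithin_of_forall fun s hs hmem => ?_)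
      have := hvy _ hmem
      rw [sub_add_cancel_left, inner_neg_right, real_inner_smul_right,
        inner_self_of_norm_eq_one hv] at this
      have hs' : δ < s := hs
      linarith
    · rw [infDist_closure, sub_add_cancel_left, norm_neg, norm_smul, hv, mul_one,
        Real.norm_of_nonneg hpos.le]
    · simp [smul_smul, hpos.ne']
  · rintro _ ⟨w, ⟨hw, hxw⟩, rfl⟩
    rw [infDist_closure, ← hδ] at hxw
    obtain ⟨v, hv, hvy⟩ := exists_unit_inner_le_zero hne hclosed hconv hw
    -- The closed `δ`-ball around `x` lies in `Ω`, so the half-space at `w` contains `x + δ • v`.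
    -- This forces equality in Cauchy–Schwarz for `w - x`.
    have hball : x + δ • v ∈ Ω := by
      rw [← hclosed.closure_eq]
      have hsub : ball x δ ⊆ Ω := fun z hz => by
        by_contra hzΩ
        exact absurd (infDist_le_dist_of_mem (x := x) (show z ∈ Ωᶜ from hzΩ))
          (not_le.2 (by rwa [dist_comm]))
      refine closure_mono hsub ?_
      rw [closure_ball x hpos.ne', mem_closedBall, dist_self_add_left, norm_smul, hv, mul_one,
        Real.norm_of_nonneg hpos.le]
    have hwx : ‖w - x‖ = δ := by rw [norm_sub_rev, hxw]
    have hle := hvy _ hball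
    rw [← sub_sub, inner_sub_right, real_inner_smul_right, inner_self_of_norm_eq_one hv,
      mul_one, sub_nonneg, ← hwx] at hle
    have heq := eq_smul_of_norm_le_inner hv hle
    have hv' : (-δ)⁻¹ • (x - w) = v := by
      rw [← neg_sub w x, heq, hwx, inv_neg, neg_smul_neg, smul_smul,
        inv_mul_cancel₀ hpos.ne', one_smul]
    simp only [hv']
    refine ⟨hv, fun y hy => ?_⟩
    have h₁ := hvy y hy
    have h₂ := inner_le_norm_of_norm_eq_one hv (w - x)
    rw [hd, show x - y = (w - y) - (w - x) by abel, inner_sub_right]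
    linarith

end FiniteDimensional

theorem activeNormals_of_mem_frontier {Ω : Set E} (hclosed : IsClosed Ω) {x : E}
    (hx : x ∈ frontier Ω) : activeNormals Ω x = sphere (0 : E) 1 ∩ normalCone Ω x := by
  have hxΩ : x ∈ Ω := hclosed.frontier_subset hx
  have hd : signedDistance Ω x = 0 := by
    rw [signedDistance_of_mem hxΩ, neg_eq_zero]
    exact infDist_zero_of_mem_closure (by rw [frontier_eq_closure_inter_closure] at hx; exact hx.2)
  ext v
  simp only [activeNormals, normalCone, hd, mem_ofPred_eq, mem_inter_iff, mem_sphere_zero_iff_norm,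
    hxΩ, true_and]
  refine and_congr_right fun _ => forall₂_congr fun y _ => ?_
  rw [← neg_sub y x, inner_neg_right, neg_nonneg]

theorem image_smul_sub_convexHull (c : ℝ) (x : E) (s : Set E) :
    (fun w => c • (x - w)) '' convexHull ℝ s = convexHull ℝ ((fun w => c • (x - w)) '' s) :=
  (c • (AffineMap.const ℝ E x - AffineMap.id ℝ E)).image_convexHull s

end SignedDistance

theorem theorem6p3 (n : ℕ) (Ω : Set (EuclideanSpace ℝ (Fin n)))
    (hne : Ω.Nonempty) (hcne : Ωᶜ.Nonempty) (hclosed : IsClosed Ω) (hconv : Convex ℝ Ω)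
    (x : EuclideanSpace ℝ (Fin n)) :
    (x ∈ Ωᶜ →
      SignedDistance.subdifferential (SignedDistance.signedDistance Ω) x =
        (fun w => (SignedDistance.signedDistance Ω x)⁻¹ • (x - w)) ''
          SignedDistance.signedProj Ω x) ∧
    (x ∈ interior Ω →
      SignedDistance.subdifferential (SignedDistance.signedDistance Ω) x =
        (fun w => (SignedDistance.signedDistance Ω x)⁻¹ • (x - w)) ''
          convexHull ℝ (SignedDistance.signedProj Ω x)) ∧
    (x ∈ frontier Ω →
      SignedDistance.subdifferential (SignedDistance.signedDistance Ω) x =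
        convexHull ℝ (Metric.sphere (0 : EuclideanSpace ℝ (Fin n)) 1 ∩
          SignedDistance.normalCone Ω x)) := by
  rw [SignedDistance.subdifferential_signedDistance hne hcne hclosed hconv x]
  refine ⟨fun hx => ?_, fun hx => ?_, fun hx => ?_⟩
  · rw [← SignedDistance.activeNormals_of_notMem hne hcne hclosed hconv hx]
    -- Outside `Ω` there is only one active normal, so the hull adds nothing.
    exact (SignedDistance.subsingleton_activeNormals_of_notMem hne hcne hclosed
      hx).convex.convexHull_eq
  · rw [SignedDistance.activeNormals_of_mem_interior hne hcne hclosed hconv hx,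
      SignedDistance.image_smul_sub_convexHull]
  · rw [SignedDistance.activeNormals_of_mem_frontier hclosed hx]
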